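/- Let $\alpha\in(0,1)$, $\nu>0$, $\xi>0$. Let $Z_1,Z_2,\dots$ be the inter-arrival times of a Prabhakar discrete-time process, that is, independent identically distributed random variables with values in the positive integers (almost surely) and with generating function $$\sum_{t\ge 1}\mathbb P(Z_j=t)\,u^t \;=\; u\,\frac{\xi^{\nu}}{\bigl(\xi+(1-u)^{\alpha}\bigr)^{\nu}},\qquad 0\le u\le 1 .$$ Let $\theta(t)=\mathbb P(Z_1=t)$ be the inter-arrival distribution, let $J_0=0$ and $J_n=Z_1+\dots+Z_n$ be the arrival times, and let $$\Phi^{(n)}(t,\xi)=\mathbb P(J_n\le t<J_{n+1})$$ be the probability of exactly $n$ arrivals within $[0,t]$. Then for every fixed $n\in\{0,1,2,\dots\}$, as $t\to\infty$ through the integers, $$\Phi^{(n)}(t,\xi)\;\sim\;\frac{\nu}{\xi}\,\frac{t^{-\alpha}}{\Gamma(1-\alpha)},$$ where the right-hand side does not depend on $n$; and the inter-arrival distribution has the fat tail $$\theta(t)\;\sim\;\frac{\alpha\nu}{\xi}\,\frac{t^{-\alpha-1}}{\Gamma(1-\alpha)}\qquad(t\to\infty).$$ Here $a(t)\sim b(t)$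 means $a(t)/b(t)\to 1$. -/

import Mathlib

open MeasureTheory ProbabilityTheory Filter

noncomputable section

/-- The generating function `u * φ(u)`, with `φ(u) = ξ ^ ν / (ξ + (1 - u) ^ α) ^ ν`, of the
inter-arrival times of the Prabhakar discrete-time process. -/
def pdtpGenFun (α ν ξ u : ℝ) : ℝ := u * (ξ ^ ν / (ξ + (1 - u) ^ α) ^ ν)

/-- `Z 0, Z 1, Z 2, …` are the inter-arrival times of a Prabhakar discrete-time process (PDTP) with
parameters `α, ν, ξ`: they are independent, and each of them has the generating function
`∑ t, P(Z j = t) u ^ t = pdtpGenFun α ν ξ u`. The value at `u = 0` says that `Z j ≠ 0` almost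
surely, and the value at `u = 1` is the total mass `1`. -/
structure IsPDTP {Ω : Type*} [MeasurableSpace Ω] (P : Measure Ω) (α ν ξ : ℝ)
    (Z : ℕ → Ω → ℕ) : Prop where
  measurable : ∀ j, Measurable (Z j)
  indep : iIndepFun Z P
  genFun : ∀ j, ∀ u ∈ Set.Icc (0 : ℝ) 1,
    HasSum (fun t : ℕ => P.real {ω | Z j ω = t} * u ^ t) (pdtpGenFun α ν ξ u)

/-- The time of the `n`-th arrival, the sum of the first `n` inter-arrival times. -/
def arrivalTime {Ω : Type*} (Z : ℕ → Ω → ℕ) (n : ℕ) (ω : Ω) : ℕ := ∑ j ∈ Finset.range n, Z j ω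

/-- The probability of exactly `n` arrivals within `[0, t]`: the `n`-th arrival happens at time `t`
at the latest, and the next one happens after time `t`. -/
def stateProb {Ω : Type*} [MeasurableSpace Ω] (P : Measure Ω) (Z : ℕ → Ω → ℕ) (n t : ℕ) : ℝ :=
  P.real {ω | arrivalTime Z n ω ≤ t ∧ t < arrivalTime Z (n + 1) ω}

/-- The inter-arrival distribution: the law of the first inter-arrival time, hence of each. -/
def interArrivalProb {Ω : Type*} [MeasurableSpace Ω] (P : Measure Ω) (Z : ℕ → Ω → ℕ) (t : ℕ) : ℝ :=
  P.real {ω | Z 0 ω = t}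

end

namespace PDTP

/-! The rest of this file proves that Prabhakar discrete-time processes exist. -/

theorem hasSum_binomial (a : ℝ) {x : ℝ} (hx0 : 0 ≤ x) (hx1 : x < 1) :
    HasSum (fun n : ℕ => (ascPochhammer ℝ n).eval a / (n.factorial : ℝ) * x ^ n)
      ((1 - x) ^ (-a)) := by
  have h := (Real.one_div_one_sub_rpow_hasFPowerSeriesOnBall_zero a).hasSum (y := x) (by
    rw [← ENNReal.ofReal_one, Metric.eball_ofReal]
    simpa [abs_lt] using ⟨by linarith, hx1⟩)
  have e : ∀ n : ℕ, (ascPochhammer ℝ n).eval a / (n.factorial : ℝ)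
      = Ring.choose (a + n - 1) n := by
    intro n
    rw [← Ring.multichoose_eq, div_eq_iff (by positivity), mul_comm, ← nsmul_eq_mul,
      Ring.factorial_nsmul_multichoose_eq_ascPochhammer, Polynomial.ascPochhammer_smeval_eq_eval]
  simp only [e]
  have hx : 0 ≤ 1 - x := by linarith
  simpa [Real.rpow_neg hx, FormalMultilinearSeries.ofScalars, mul_comm] using h

theorem hasSum_one_of_nonneg {b : ℕ → ℝ} {F : ℝ → ℝ} {l : ℝ} (hb : ∀ n, 0 ≤ b n)
    (hF : ∀ u, 0 ≤ u → u < 1 → HasSum (fun n => b n * u ^ n) (F u))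
    (hl : Tendsto F (nhdsWithin 1 (Set.Iio 1)) (nhds l)) : HasSum b l := by
  have ev : ∀ᶠ u : ℝ in nhdsWithin 1 (Set.Iio 1), 0 ≤ u ∧ u < 1 := by
    filter_upwards [self_mem_nhdsWithin,
      nhdsWithin_le_nhds (lt_mem_nhds (show (0 : ℝ) < 1 by norm_num))] with u h1 h2
    exact ⟨h2.le, h1⟩
  have hs : Summable b := by
    refine summable_of_sum_range_le (c := l) hb fun n => ?_
    have h1 : Tendsto (fun u : ℝ => ∑ i ∈ Finset.range n, b i * u ^ i)
        (nhdsWithin 1 (Set.Iio 1)) (nhds (∑ i ∈ Finset.range n, b i)) := by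
      have : Continuous (fun u : ℝ => ∑ i ∈ Finset.range n, b i * u ^ i) := by fun_prop
      simpa using (this.tendsto 1).mono_left nhdsWithin_le_nhds
    refine le_of_tendsto_of_tendsto h1 hl ?_
    filter_upwards [ev] with u hu
    exact sum_le_hasSum _ (fun i _ => mul_nonneg (hb i) (pow_nonneg hu.1 i)) (hF u hu.1 hu.2)
  have h2 := Real.tendsto_tsum_powerSeries_nhdsWithin_lt hs.hasSum.tendsto_sum_nat
  have h3 : Tendsto F (nhdsWithin 1 (Set.Iio 1)) (nhds (∑' n, b n)) := by
    refine h2.congr' ?_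
    filter_upwards [ev] with u hu
    exact (hF u hu.1 hu.2).tsum_eq
  rw [tendsto_nhds_unique hl h3]
  exact hs.hasSum

theorem exists_sibuya {α : ℝ} (hα : 0 < α) (hα1 : α < 1) :
    ∃ s : ℕ → ℝ, (∀ n, 0 ≤ s n) ∧
      ∀ u ∈ Set.Icc (0 : ℝ) 1, HasSum (fun n => s n * u ^ n) (1 - (1 - u) ^ α) := by
  have hneg : ∀ n : ℕ, (ascPochhammer ℝ (n + 1)).eval (-α) ≤ 0 := by
    intro n
    induction n with
    | zero => simpa using hα.le
    | succ n ih =>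
      rw [ascPochhammer_succ_eval]
      refine mul_nonpos_of_nonpos_of_nonneg ih ?_
      push_cast
      have : (0 : ℝ) ≤ n := n.cast_nonneg
      linarith
  set s : ℕ → ℝ := fun n => (if n = 0 then 1 else 0)
    - (ascPochhammer ℝ n).eval (-α) / (n.factorial : ℝ) with hs
  have h0 : ∀ n, 0 ≤ s n := by
    intro n
    cases n with
    | zero => simp [hs]
    | succ n =>
      have : (ascPochhammer ℝ (n + 1)).eval (-α) / ((n + 1).factorial : ℝ) ≤ 0 :=
        div_nonpos_of_nonpos_of_nonneg (hneg n) (by positivity)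
      simp only [hs, Nat.succ_ne_zero, if_false]
      linarith
  have h1 : ∀ u : ℝ, 0 ≤ u → u < 1 → HasSum (fun n => s n * u ^ n) (1 - (1 - u) ^ α) := by
    intro u hu0 hu1
    have h := hasSum_binomial (-α) hu0 hu1
    rw [neg_neg] at h
    have h' : HasSum (fun n : ℕ => if n = 0 then (1 : ℝ) else 0) 1 := hasSum_ite_eq 0 1
    refine (h'.sub h).congr_fun ?_
    intro n
    by_cases hn : n = 0
    · simp [hs, hn]
    · simp [hs, hn]
  refine ⟨s, h0, fun u hu => ?_⟩
  rcases hu.2.lt_or_eq with h | rfl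
  · exact h1 u hu.1 h
  · have hc : Tendsto (fun u : ℝ => 1 - (1 - u) ^ α) (nhdsWithin 1 (Set.Iio 1))
        (nhds (1 - (1 - 1) ^ α)) := by
      have : Continuous (fun u : ℝ => 1 - (1 - u) ^ α) :=
        continuous_const.sub ((continuous_const.sub continuous_id).rpow_const
          fun _ => Or.inr hα.le)
      exact (this.tendsto 1).mono_left nhdsWithin_le_nhds
    simpa using hasSum_one_of_nonneg h0 h1 hc

/-- Power series with nonnegative coefficients compose. -/
theorem exists_comp {s w : ℕ → ℝ} {S W : ℝ → ℝ} (hs : ∀ n, 0 ≤ s n) (hw : ∀ n, 0 ≤ w n)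
    (hS : ∀ u ∈ Set.Icc (0 : ℝ) 1, HasSum (fun n => s n * u ^ n) (S u))
    (hW : ∀ u ∈ Set.Icc (0 : ℝ) 1, HasSum (fun n => w n * S u ^ n) (W u)) :
    ∃ p : ℕ → ℝ, (∀ n, 0 ≤ p n) ∧
      ∀ u ∈ Set.Icc (0 : ℝ) 1, HasSum (fun n => p n * u ^ n) (W u) := by
  have hpow : ∀ m : ℕ, ∃ q : ℕ → ℝ, (∀ n, 0 ≤ q n) ∧
      ∀ u ∈ Set.Icc (0 : ℝ) 1, HasSum (fun n => q n * u ^ n) (S u ^ m) := by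
    intro m
    induction m with
    | zero =>
      refine ⟨fun n => if n = 0 then 1 else 0, fun n => by positivity, fun u _ => ?_⟩
      simpa using hasSum_ite_eq (0 : ℕ) (1 : ℝ) |>.congr_fun (g := fun n : ℕ =>
        (if n = 0 then (1 : ℝ) else 0) * u ^ n) (by intro n; by_cases hn : n = 0 <;> simp [hn])
    | succ m ih =>
      obtain ⟨q, hq, hqs⟩ := ih
      refine ⟨fun n => ∑ kl ∈ Finset.HasAntidiagonal.antidiagonal n, q kl.1 * s kl.2,
        fun n => Finset.sum_nonneg fun kl _ => mul_nonneg (hq _) (hs _), fun u hu => ?_⟩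
      have n1 : Summable fun n => ‖q n * u ^ n‖ := (hqs u hu).summable.norm
      have n2 : Summable fun n => ‖s n * u ^ n‖ := (hS u hu).summable.norm
      have h := (summable_norm_sum_mul_antidiagonal_of_summable_norm n1 n2).of_norm.hasSum
      rw [← tsum_mul_tsum_eq_tsum_sum_antidiagonal_of_summable_norm n1 n2, (hqs u hu).tsum_eq,
        (hS u hu).tsum_eq] at h
      rw [pow_succ]
      refine h.congr_fun fun n => ?_
      rw [Finset.sum_mul]
      refine Finset.sum_congr rfl fun kl hkl => ?_
      rw [← Finset.HasAntidiagonal.mem_antidiagonal.mp hkl, pow_add]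
      ring
  choose q hq hqs using hpow
  have key : ∀ u ∈ Set.Icc (0 : ℝ) 1,
      Summable (fun x : ℕ × ℕ => w x.1 * (q x.1 x.2 * u ^ x.2)) := by
    intro u hu
    refine (summable_prod_of_nonneg fun x => mul_nonneg (hw _)
      (mul_nonneg (hq _ _) (pow_nonneg hu.1 _))).2
      ⟨fun m => ((hqs m u hu).mul_left (w m)).summable, ?_⟩
    refine (hW u hu).summable.congr fun m => ?_
    exact ((hqs m u hu).mul_left (w m)).tsum_eq.symm
  refine ⟨fun n => ∑' m, w m * q m n,
    fun n => tsum_nonneg fun m => mul_nonneg (hw _) (hq _ _), fun u hu => ?_⟩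
  have h1 : HasSum (fun x : ℕ × ℕ => w x.1 * (q x.1 x.2 * u ^ x.2)) (W u) := by
    have h := (key u hu).hasSum.prod_fiberwise fun m => (hqs m u hu).mul_left (w m)
    rw [← h.unique (hW u hu)]
    exact (key u hu).hasSum
  have h2 : HasSum (fun x : ℕ × ℕ => w x.2 * (q x.2 x.1 * u ^ x.1)) (W u) :=
    (Equiv.prodComm ℕ ℕ).hasSum_iff.mpr h1
  have h3 := h2.prod_fiberwise fun n => (h2.summable.prod_factor n).hasSum
  refine h3.congr_fun fun n => ?_
  simp only [← mul_assoc, tsum_mul_right]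

theorem exists_pdtp_coeff {α ν ξ : ℝ} (hα : 0 < α) (hα1 : α < 1) (hν : 0 < ν) (hξ : 0 < ξ) :
    ∃ p : ℕ → ℝ, (∀ n, 0 ≤ p n) ∧
      ∀ u ∈ Set.Icc (0 : ℝ) 1, HasSum (fun n => p n * u ^ n) (pdtpGenFun α ν ξ u) := by
  obtain ⟨s, hs, hS⟩ := exists_sibuya hα hα1
  have h1ξ : 0 < 1 + ξ := by linarith
  obtain ⟨p, hp, hP⟩ := exists_comp (W := fun u => ξ ^ ν / (ξ + (1 - u) ^ α) ^ ν)
    (w := fun n => (ξ / (1 + ξ)) ^ ν * ((ascPochhammer ℝ n).eval ν /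
        (n.factorial : ℝ) * (1 / (1 + ξ)) ^ n)) hs
    (fun n => by have := ascPochhammer_pos n ν hν; positivity) hS (by
      intro u hu
      have hv : 0 ≤ (1 - u) ^ α := Real.rpow_nonneg (by linarith [hu.2]) _
      have hv1 : (1 - u) ^ α ≤ 1 :=
        Real.rpow_le_one (by linarith [hu.2]) (by linarith [hu.1]) hα.le
      have h := (hasSum_binomial ν (x := (1 - (1 - u) ^ α) / (1 + ξ)) (by
        apply div_nonneg <;> linarith) (by rw [div_lt_one h1ξ]; linarith)).mul_left
          ((ξ / (1 + ξ)) ^ ν)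
      have e : (ξ / (1 + ξ)) ^ ν * (1 - (1 - (1 - u) ^ α) / (1 + ξ)) ^ (-ν)
          = ξ ^ ν / (ξ + (1 - u) ^ α) ^ ν := by
        have : 1 - (1 - (1 - u) ^ α) / (1 + ξ) = (ξ + (1 - u) ^ α) / (1 + ξ) := by
          field_simp; ring
        rw [this, Real.rpow_neg (by positivity), Real.div_rpow hξ.le h1ξ.le,
          Real.div_rpow (by positivity) h1ξ.le]
        have a1 : (0 : ℝ) < (1 + ξ) ^ ν := Real.rpow_pos_of_pos h1ξ _
        have a2 : (0 : ℝ) < (ξ + (1 - u) ^ α) ^ ν := Real.rpow_pos_of_pos (by linarith) _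
        field_simp
      rw [e] at h
      refine h.congr_fun fun n => ?_
      simp only [div_pow, one_pow]
      ring)
  refine ⟨fun n => n.casesOn 0 p, fun n => by cases n <;> simp [hp], fun u hu => ?_⟩
  rw [← hasSum_nat_add_iff' 1]
  have h := ((hP u hu).mul_left u).congr_fun (g := fun n => p n * u ^ (n + 1))
    fun n => by ring
  simpa [pdtpGenFun] using h

/-- A Prabhakar discrete-time process exists for all admissible parameters. -/
theorem exists_isPDTP {α ν ξ : ℝ} (hα : 0 < α) (hα1 : α < 1) (hν : 0 < ν) (hξ : 0 < ξ) :
    ∃ (P : Measure (ℕ → ℕ)) (Z : ℕ → (ℕ → ℕ) → ℕ), IsProbabilityMeasure P ∧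
      IsPDTP P α ν ξ Z := by
  obtain ⟨p, hp, hP⟩ := exists_pdtp_coeff hα hα1 hν hξ
  have h1 : HasSum p 1 := by
    simpa [pdtpGenFun, Real.zero_rpow hα.ne', (Real.rpow_pos_of_pos hξ ν).ne'] using hP 1 (by simp)
  let μ : PMF ℕ := ⟨fun n => ENNReal.ofReal (p n), by
    rw [← ENNReal.ofReal_one, ← h1.tsum_eq, ENNReal.ofReal_tsum_of_nonneg hp h1.summable]
    exact ENNReal.summable.hasSum⟩
  refine ⟨Measure.infinitePi fun _ => μ.toMeasure, fun j ω => ω j, inferInstance,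
    fun j => measurable_pi_apply j,
    iIndepFun_infinitePi (X := fun _ x => x) fun _ => measurable_id, fun j u hu => ?_⟩
  refine (hP u hu).congr_fun fun n => ?_
  congr 1
  have hm : {ω : ℕ → ℕ | ω j = n} = (fun ω => ω j) ⁻¹' {n} := rfl
  rw [hm, measureReal_def, ← Measure.map_apply (measurable_pi_apply j) (measurableSet_singleton n),
    Measure.infinitePi_map_eval, PMF.toMeasure_apply_singleton _ _ (measurableSet_singleton n)]
  exact ENNReal.toReal_ofReal (hp n)

end PDTP

/-! ### Uniqueness of power series coefficients -/

open Finset.HasAntidiagonal (antidiagonal mem_antidiagonal)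

/-! Put `S u = 1 - (1 - u) ^ α`, the Sibuya generating function. Since `ξ + (1 - u) ^ α = (1 + ξ) -
S u`, the inter-arrival generating function is `u` times a negative binomial generating function
evaluated at `S u`: an inter-arrival time is one plus a negative binomial number of independent
Sibuya variables.

Sibuya weights are explicit, and Euler's limit for `Γ(-α)` gives them the tail `α / Γ(1 - α) * t ^
(-α - 1)` (`tendsto_binomial_coeff`). Such tails obey the one-big-jump principle: an `m`-fold
convolution has `m` times the tail (`tendsto_conv`, `tendsto_coeff_pow`). A bound polynomial in `m`
(`coeff_pow_mul_rpow_le`) permits dominated convergence over the number of summands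
(`tendsto_compound`), so the tail is multiplied by the negative binomial mean `ν / ξ`. This yields
the asymptotics of `θ` pointwise, without a Tauberian theorem.

The same principle gives `J_n` the mass `n * θ(t)` to leading order, and summation (`tendsto_tail`)
gives the tail of `J_n`. The state probability is the tail of `J_(n+1)` minus that of `J_n`, so `n`
cancels. -/

theorem eq_zero_of_hasSum_zero {d : ℕ → ℝ}
    (hd : ∀ u ∈ Set.Ico (0 : ℝ) 1, HasSum (fun n => d n * u ^ n) 0) (n : ℕ) : d n = 0 := by
  induction n using Nat.strong_induction_on with
  | _ k ih =>
  -- With the first `k` coefficients zero, divide by `u ^ k` and let `u` decrease to `0`; only `d k`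
  -- survives. The series at `1 / 2` dominates.
  have hshift : ∀ u ∈ Set.Ioo (0 : ℝ) 1, HasSum (fun j => d (j + k) * u ^ j) 0 := by
    intro u hu
    have h := hd u ⟨hu.1.le, hu.2⟩
    rw [← hasSum_nat_add_iff' k, Finset.sum_eq_zero
      (fun i hi => by rw [ih i (Finset.mem_range.mp hi), zero_mul]), sub_zero] at h
    have h2 := h.mul_left ((u ^ k)⁻¹)
    rw [mul_zero] at h2
    refine h2.congr_fun fun j => ?_
    have : u ^ k ≠ 0 := (pow_pos hu.1 k).ne'
    rw [pow_add]
    field_simp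
  have hb : Summable fun j => ‖d (j + k) * (1 / 2 : ℝ) ^ j‖ :=
    (hshift (1 / 2) (by norm_num)).summable.norm
  have h1 : Tendsto (fun u : ℝ => ∑' j, d (j + k) * u ^ j) (nhdsWithin 0 (Set.Ioi 0))
      (nhds (∑' j, d (j + k) * (0 : ℝ) ^ j)) := by
    refine tendsto_tsum_of_dominated_convergence hb (fun j => ?_) ?_
    · have : Continuous fun u : ℝ => d (j + k) * u ^ j := by fun_prop
      exact (this.tendsto 0).mono_left nhdsWithin_le_nhds
    · filter_upwards [Ioo_mem_nhdsGT (show (0 : ℝ) < 1 / 2 by norm_num)] with u hu j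
      rw [norm_mul, norm_mul, norm_pow, norm_pow]
      gcongr
      rw [Real.norm_of_nonneg hu.1.le, Real.norm_of_nonneg (by norm_num)]
      exact hu.2.le
  have h2 : Tendsto (fun u : ℝ => ∑' j, d (j + k) * u ^ j) (nhdsWithin 0 (Set.Ioi 0))
      (nhds 0) := by
    refine tendsto_const_nhds.congr' ?_
    filter_upwards [Ioo_mem_nhdsGT (show (0 : ℝ) < 1 by norm_num)] with u hu
    exact (hshift u hu).tsum_eq.symm
  have h3 := tendsto_nhds_unique h1 h2
  rw [tsum_eq_single 0 (fun j hj => by simp [hj])] at h3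
  simpa using h3

/-- The coefficients of a power series are determined by its values on `[0, 1)`. -/
theorem coeff_unique_of_hasSum {a b : ℕ → ℝ} {F : ℝ → ℝ}
    (ha : ∀ u ∈ Set.Ico (0 : ℝ) 1, HasSum (fun n => a n * u ^ n) (F u))
    (hb : ∀ u ∈ Set.Ico (0 : ℝ) 1, HasSum (fun n => b n * u ^ n) (F u)) : a = b := by
  funext n
  have := eq_zero_of_hasSum_zero (d := fun n => a n - b n) (fun u hu => by
    simpa [sub_mul] using (ha u hu).sub (hb u hu)) n
  linarith

/-! ### Convolution of sequences with power tails -/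

theorem exists_abs_mul_rpow_le {a : ℕ → ℝ} {β c : ℝ}
    (ha : Tendsto (fun t : ℕ => a t * (t : ℝ) ^ β) atTop (nhds c)) :
    ∃ C, 0 ≤ C ∧ ∀ t : ℕ, |a t| * (t : ℝ) ^ β ≤ C := by
  obtain ⟨C, hC⟩ := ha.abs.bddAbove_range
  have hC' : ∀ t : ℕ, |a t| * (t : ℝ) ^ β ≤ C := fun t => by
    have : |a t * (t : ℝ) ^ β| ≤ C := hC ⟨t, rfl⟩
    rwa [abs_mul, abs_of_nonneg (Real.rpow_nonneg t.cast_nonneg β)] at this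
  exact ⟨C, le_trans (by positivity) (hC' 0), hC'⟩

/-- One half of a convolution: the part where the first index is small. -/
theorem tendsto_half_conv {a b : ℕ → ℝ} {β d : ℝ} (hβ : 0 ≤ β) (hs : Summable a)
    (hb : Tendsto (fun t : ℕ => b t * (t : ℝ) ^ β) atTop (nhds d))
    (R : ℕ → ℕ → Prop) [∀ t j, Decidable (R t j)] (hR : ∀ t j, R t j → 2 * j ≤ t)
    (hR' : ∀ j, ∀ᶠ t in atTop, R t j) :
    Tendsto (fun t : ℕ => ∑' j, if R t j then a j * b (t - j) * (t : ℝ) ^ β else 0) atTop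
      (nhds (d * ∑' j, a j)) := by
  obtain ⟨D, hD0, hD⟩ := exists_abs_mul_rpow_le hb
  rw [← tsum_mul_left]
  refine tendsto_tsum_of_dominated_convergence (bound := fun j => |a j| * (2 ^ β * D))
    (hs.abs.mul_right _) (fun j => ?_) (Eventually.of_forall fun t j => ?_)
  · have h1 : Tendsto (fun t : ℕ => b (t - j) * ((t - j : ℕ) : ℝ) ^ β) atTop (nhds d) :=
      hb.comp (tendsto_sub_atTop_nat j)
    have h2 : Tendsto (fun t : ℕ => (1 + (j : ℝ) / ((t - j : ℕ) : ℝ)) ^ β) atTop (nhds 1) := by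
      have h0 : Tendsto (fun t : ℕ => (j : ℝ) / ((t - j : ℕ) : ℝ)) atTop (nhds 0) :=
        (tendsto_const_div_atTop_nhds_zero_nat (j : ℝ)).comp (tendsto_sub_atTop_nat j)
      have h3 := (h0.const_add 1).rpow_const (p := β) (Or.inl (by simp))
      simpa using h3
    have h3 := (h1.mul h2).const_mul (a j)
    rw [mul_one, mul_comm (a j) d] at h3
    refine h3.congr' ?_
    filter_upwards [hR' j, eventually_gt_atTop j] with t ht hjt
    rw [if_pos ht]
    have hpos : (0 : ℝ) < ((t - j : ℕ) : ℝ) := by exact_mod_cast Nat.sub_pos_of_lt hjt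
    have : (t : ℝ) = ((t - j : ℕ) : ℝ) * (1 + (j : ℝ) / ((t - j : ℕ) : ℝ)) := by
      field_simp
      rw [Nat.cast_sub hjt.le]; ring
    conv_rhs => rw [this, Real.mul_rpow hpos.le (by positivity)]
    ring
  -- Here `j ≤ t / 2`, so `t ≤ 2 * (t - j)` and replacing `t - j` by `t` costs at most `2 ^ β`.
  · by_cases h : R t j
    · rw [if_pos h, norm_mul, norm_mul, Real.norm_eq_abs, Real.norm_eq_abs,
        Real.norm_of_nonneg (Real.rpow_nonneg t.cast_nonneg β)]
      have h2 := hR t j h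
      have h3 : (t : ℝ) ≤ 2 * ((t - j : ℕ) : ℝ) := by
        rw [Nat.cast_sub (by omega)]
        have : (2 : ℝ) * j ≤ t := by exact_mod_cast h2
        linarith
      have h4 : (t : ℝ) ^ β ≤ 2 ^ β * ((t - j : ℕ) : ℝ) ^ β := by
        rw [← Real.mul_rpow (by norm_num) (by positivity)]
        exact Real.rpow_le_rpow (by positivity) h3 hβ
      calc |a j| * |b (t - j)| * (t : ℝ) ^ β
          ≤ |a j| * |b (t - j)| * (2 ^ β * ((t - j : ℕ) : ℝ) ^ β) := by gcongr
        _ = |a j| * (2 ^ β * (|b (t - j)| * ((t - j : ℕ) : ℝ) ^ β)) := by ring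
        _ ≤ |a j| * (2 ^ β * D) := by gcongr; exact hD _
    · rw [if_neg h, norm_zero]
      positivity

/-- Convolution of two summable sequences with power tails. -/
theorem tendsto_conv {a b : ℕ → ℝ} {β c d A B : ℝ} (hβ : 0 ≤ β) (hA : HasSum a A)
    (hB : HasSum b B)
    (ha : Tendsto (fun t : ℕ => a t * (t : ℝ) ^ β) atTop (nhds c))
    (hb : Tendsto (fun t : ℕ => b t * (t : ℝ) ^ β) atTop (nhds d)) :
    Tendsto (fun t : ℕ => (∑ kl ∈ antidiagonal t, a kl.1 * b kl.2) * (t : ℝ) ^ β) atTop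
      (nhds (d * A + c * B)) := by
  -- The antidiagonal is cut in the middle; `≤` on one side and `<` on the other count the midpoint
  -- once.
  have h1 := tendsto_half_conv hβ hA.summable hb (fun t j => 2 * j ≤ t) (fun _ _ h => h)
    (fun j => eventually_ge_atTop (2 * j))
  have h2 := tendsto_half_conv hβ hB.summable ha (fun t j => 2 * j < t) (fun _ _ h => h.le)
    (fun j => eventually_gt_atTop (2 * j))
  rw [hA.tsum_eq] at h1
  rw [hB.tsum_eq] at h2
  refine (h1.add h2).congr fun t => ?_
  have hfin : ∀ (f : ℕ → ℝ) (R : ℕ → Prop) [DecidablePred R], (∀ j, R j → 2 * j ≤ t) →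
      ∑' j, (if R j then f j else 0) = ∑ j ∈ Finset.range (t + 1), if R j then f j else 0 := by
    intro f R _ hR
    refine tsum_eq_sum fun j hj => if_neg fun h => ?_
    have := hR j h
    simp only [Finset.mem_range] at hj
    omega
  rw [hfin _ (fun j => 2 * j ≤ t) (fun _ h => h), hfin _ (fun j => 2 * j < t) (fun _ h => h.le),
    ← Finset.sum_range_reflect (fun j => if 2 * j < t then _ else _), ← Finset.sum_add_distrib,
    Finset.Nat.sum_antidiagonal_eq_sum_range_succ (fun i j => a i * b j), Finset.sum_mul]
  refine Finset.sum_congr rfl fun j hj => ?_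
  rw [Finset.mem_range] at hj
  have e1 : t + 1 - 1 - j = t - j := by omega
  have e2 : t - (t - j) = j := by omega
  simp only [e1, e2]
  by_cases h : 2 * j ≤ t
  · rw [if_pos h, if_neg (by omega), add_zero]
  · rw [if_neg h, if_pos (by omega), zero_add]
    ring

/-! ### Convolution powers, encoded as powers of formal power series -/

theorem hasSum_coeff_pow {p : ℕ → ℝ} {S u : ℝ} (hS : HasSum (fun n => p n * u ^ n) S) (m : ℕ) :
    HasSum (fun n => PowerSeries.coeff n (PowerSeries.mk p ^ m) * u ^ n) (S ^ m) := by
  induction m with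
  | zero =>
    simpa using hasSum_ite_eq (0 : ℕ) (1 : ℝ) |>.congr_fun (g := fun n : ℕ =>
      PowerSeries.coeff n (1 : PowerSeries ℝ) * u ^ n) (by
        intro n; by_cases hn : n = 0 <;> simp [hn, PowerSeries.coeff_one])
  | succ m ih =>
    have n1 := ih.summable.norm
    have n2 := hS.summable.norm
    have h := (summable_norm_sum_mul_antidiagonal_of_summable_norm n1 n2).of_norm.hasSum
    rw [← tsum_mul_tsum_eq_tsum_sum_antidiagonal_of_summable_norm n1 n2, ih.tsum_eq,
      hS.tsum_eq] at h
    simp only [pow_succ]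
    refine h.congr_fun fun n => ?_
    rw [PowerSeries.coeff_mul, Finset.sum_mul]
    refine Finset.sum_congr rfl fun kl hkl => ?_
    rw [← mem_antidiagonal.mp hkl, pow_add, PowerSeries.coeff_mk]
    ring

theorem hasSum_coeff_pow_one {p : ℕ → ℝ} (hp : HasSum p 1) (m : ℕ) :
    HasSum (fun n => PowerSeries.coeff n (PowerSeries.mk p ^ m)) 1 := by
  have h := hasSum_coeff_pow (p := p) (S := 1) (u := 1) (by simpa using hp) m
  simpa only [one_pow, mul_one] using h

theorem coeff_pow_nonneg {p : ℕ → ℝ} (hp : ∀ n, 0 ≤ p n) (m t : ℕ) :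
    0 ≤ PowerSeries.coeff t (PowerSeries.mk p ^ m) := by
  induction m generalizing t with
  | zero => rw [pow_zero, PowerSeries.coeff_one]; positivity
  | succ m ih =>
    rw [pow_succ, PowerSeries.coeff_mul]
    exact Finset.sum_nonneg fun kl _ => mul_nonneg (ih _) (by simpa using hp _)

/-- All total masses are one, so each further factor adds exactly one `c`: any one of the `m` terms
may be the big one. -/
theorem tendsto_coeff_pow {p : ℕ → ℝ} {β c : ℝ} (hβ : 0 ≤ β) (hp : HasSum p 1)
    (hc : Tendsto (fun t : ℕ => p t * (t : ℝ) ^ β) atTop (nhds c)) (m : ℕ) :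
    Tendsto (fun t : ℕ => PowerSeries.coeff t (PowerSeries.mk p ^ m) * (t : ℝ) ^ β) atTop
      (nhds (m * c)) := by
  induction m with
  | zero =>
    simp only [Nat.cast_zero, zero_mul]
    refine tendsto_const_nhds.congr' ?_
    filter_upwards [eventually_gt_atTop 0] with t ht
    simp [PowerSeries.coeff_one, ht.ne']
  | succ m ih =>
    have hs := hasSum_coeff_pow_one hp m
    have h := tendsto_conv hβ hs hp ih hc
    have e : c * 1 + m * c * 1 = ((m + 1 : ℕ) : ℝ) * c := by push_cast; ring
    rw [e] at h
    refine h.congr fun t => ?_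
    rw [pow_succ, PowerSeries.coeff_mul]
    simp

/-- A bound, polynomial in the number of factors, for convolution powers of a power tail. -/
theorem coeff_pow_mul_rpow_le {p : ℕ → ℝ} {β C : ℝ} (hβ : 0 ≤ β) (h0 : ∀ n, 0 ≤ p n)
    (hp : HasSum p 1) (hC0 : 0 ≤ C) (hC : ∀ t : ℕ, p t * (t : ℝ) ^ β ≤ C) (m t : ℕ) (ht : 0 < t) :
    PowerSeries.coeff t (PowerSeries.mk p ^ m) * (t : ℝ) ^ β ≤ C * (m * (m : ℝ) ^ β) := by
  induction m generalizing t with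
  | zero => simp [PowerSeries.coeff_one, ht.ne']
  | succ m ih =>
    have hs := hasSum_coeff_pow_one hp m
    set q : ℕ → ℝ := fun n => PowerSeries.coeff n (PowerSeries.mk p ^ m) with hq
    have hq0 : ∀ n, 0 ≤ q n := coeff_pow_nonneg h0 m
    set M : ℝ := ((m + 1 : ℕ) : ℝ) with hM
    have hM0 : 0 < M := by positivity
    -- Pigeonhole on `k + l = t`: either `l ≥ t / M`, where the bound on `p` applies, or `k ≥ m * t
    -- / M`, where the induction hypothesis does and its `m ^ β` cancels. Summing over masses at
    -- most one gives `C * M ^ β * (1 + m)`.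
    have key : ∀ kl ∈ antidiagonal t, q kl.1 * p kl.2 * (t : ℝ) ^ β
        ≤ C * M ^ β * q kl.1 + C * m * M ^ β * p kl.2 := by
      intro kl hkl
      have hsum : (kl.1 : ℝ) + kl.2 = t := by exact_mod_cast mem_antidiagonal.mp hkl
      rcases le_total ((t : ℝ)) (M * kl.2) with h | h
      · have h4 : (t : ℝ) ^ β ≤ M ^ β * (kl.2 : ℝ) ^ β := by
          rw [← Real.mul_rpow hM0.le (by positivity)]
          exact Real.rpow_le_rpow (by positivity) h hβ
        calc q kl.1 * p kl.2 * (t : ℝ) ^ β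
            ≤ q kl.1 * p kl.2 * (M ^ β * (kl.2 : ℝ) ^ β) :=
              mul_le_mul_of_nonneg_left h4 (mul_nonneg (hq0 _) (h0 _))
          _ = M ^ β * q kl.1 * (p kl.2 * (kl.2 : ℝ) ^ β) := by ring
          _ ≤ M ^ β * q kl.1 * C :=
              mul_le_mul_of_nonneg_left (hC _) (mul_nonneg (by positivity) (hq0 _))
          _ ≤ C * M ^ β * q kl.1 + C * m * M ^ β * p kl.2 := by
              have : 0 ≤ C * m * M ^ β * p kl.2 := mul_nonneg (by positivity) (h0 _)
              linarith
      · have hle : (m : ℝ) * t ≤ M * kl.1 := by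
          have : M = m + 1 := by rw [hM]; push_cast; ring
          rw [this] at h ⊢
          nlinarith
        -- The induction hypothesis needs a positive index; `k = 0` forces `m = 0` and `l = t`.
        rcases Nat.eq_zero_or_pos kl.1 with hz | hz
        · have ht' : (0 : ℝ) < t := by exact_mod_cast ht
          rw [hz, Nat.cast_zero, mul_zero] at hle
          have hm : m = 0 := by
            have h5 : (m : ℝ) ≤ 0 := by nlinarith
            exact_mod_cast le_antisymm h5 m.cast_nonneg
          have hM1 : M = 1 := by rw [hM, hm]; norm_num
          rw [hz, Nat.cast_zero, zero_add] at hsum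
          have h6 := mul_le_mul_of_nonneg_left (hC kl.2) (hq0 kl.1)
          rw [hM1, hm, ← hsum]
          simp only [Real.one_rpow, Nat.cast_zero]
          linarith
        · have h7 : (m : ℝ) ^ β * (t : ℝ) ^ β ≤ M ^ β * (kl.1 : ℝ) ^ β := by
            rw [← Real.mul_rpow (by positivity) (by positivity),
              ← Real.mul_rpow (by positivity) (by positivity)]
            exact Real.rpow_le_rpow (by positivity) hle hβ
          have h8 := ih kl.1 hz
          have h9 : q kl.1 * (t : ℝ) ^ β ≤ C * m * M ^ β := by
            rcases Nat.eq_zero_or_pos m with hm | hm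
            · have : q kl.1 = 0 := by simp [hq, hm, PowerSeries.coeff_one, hz.ne']
              rw [this, zero_mul]; positivity
            · have hmβ : (0 : ℝ) < (m : ℝ) ^ β := Real.rpow_pos_of_pos (by exact_mod_cast hm) _
              refine le_of_mul_le_mul_left ?_ hmβ
              calc (m : ℝ) ^ β * (q kl.1 * (t : ℝ) ^ β)
                  = q kl.1 * ((m : ℝ) ^ β * (t : ℝ) ^ β) := by ring
                _ ≤ q kl.1 * (M ^ β * (kl.1 : ℝ) ^ β) := mul_le_mul_of_nonneg_left h7 (hq0 _)
                _ = M ^ β * (q kl.1 * (kl.1 : ℝ) ^ β) := by ring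
                _ ≤ M ^ β * (C * (m * (m : ℝ) ^ β)) :=
                    mul_le_mul_of_nonneg_left h8 (by positivity)
                _ = (m : ℝ) ^ β * (C * m * M ^ β) := by ring
          have h10 := mul_le_mul_of_nonneg_right h9 (h0 kl.2)
          have h11 : 0 ≤ C * M ^ β * q kl.1 := mul_nonneg (by positivity) (hq0 _)
          linarith
    have hsq : ∑ kl ∈ antidiagonal t, q kl.1 ≤ 1 := by
      rw [Finset.Nat.sum_antidiagonal_eq_sum_range_succ (fun i _ => q i)]
      exact sum_le_hasSum _ (fun i _ => hq0 i) hs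
    have hsp : ∑ kl ∈ antidiagonal t, p kl.2 ≤ 1 := by
      rw [← Finset.Nat.sum_antidiagonal_swap]
      simp only [Prod.snd_swap]
      rw [Finset.Nat.sum_antidiagonal_eq_sum_range_succ (fun i _ => p i)]
      exact sum_le_hasSum _ (fun i _ => h0 i) hp
    rw [pow_succ, PowerSeries.coeff_mul, Finset.sum_mul]
    simp only [PowerSeries.coeff_mk]
    refine (Finset.sum_le_sum key).trans ?_
    rw [Finset.sum_add_distrib, ← Finset.mul_sum, ← Finset.mul_sum]
    have i1 := mul_le_mul_of_nonneg_left hsq (show 0 ≤ C * M ^ β by positivity)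
    have i2 := mul_le_mul_of_nonneg_left hsp (show 0 ≤ C * m * M ^ β by positivity)
    have : M = m + 1 := by rw [hM]; push_cast; ring
    calc _ ≤ C * M ^ β * 1 + C * m * M ^ β * 1 := add_le_add i1 i2
      _ = C * ((m + 1) * M ^ β) := by ring
      _ = _ := by rw [← this]

/-! ### Sibuya weights -/

theorem ascPochhammer_eval_eq_prod (a : ℝ) (n : ℕ) :
    (ascPochhammer ℝ n).eval a = ∏ j ∈ Finset.range n, (a + j) := by
  induction n with
  | zero => simp
  | succ n ih => rw [ascPochhammer_succ_eval, ih, Finset.prod_range_succ]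

/-- The coefficients of `(1 - u) ^ α` decay like `n ^ (-α - 1) / Γ(-α)`. -/
theorem tendsto_binomial_coeff {α : ℝ} (hα : 0 < α) (hα1 : α < 1) :
    Tendsto (fun n : ℕ => -((ascPochhammer ℝ n).eval (-α) / (n.factorial : ℝ)) * (n : ℝ) ^ (α + 1))
      atTop (nhds (α / Real.Gamma (1 - α))) := by
  have hG : Real.Gamma (1 - α) = -α * Real.Gamma (-α) := by
    rw [← Real.Gamma_add_one (by linarith : -α ≠ 0)]; congr 1; ring
  have hG0 : 0 < Real.Gamma (1 - α) := Real.Gamma_pos_of_pos (by linarith)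
  have hG1 : Real.Gamma (-α) ≠ 0 := by
    intro h; rw [hG, h, mul_zero] at hG0; exact lt_irrefl _ hG0
  have h1 := (Real.GammaSeq_tendsto_Gamma (-α)).inv₀ hG1
  have h2 : Tendsto (fun n : ℕ => (1 + 1 / (n : ℝ)) ^ α) atTop (nhds 1) := by
    have h3 := ((tendsto_const_div_atTop_nhds_zero_nat (1 : ℝ)).const_add 1).rpow_const (p := α)
      (Or.inl (by simp))
    simpa using h3
  have h3 := (h1.mul h2).neg
  -- `Real.GammaSeq (-α) n` has `n + 1` factors in its denominator, so it matches the coefficient of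
  -- index `n + 1`, up to `((n + 1) / n) ^ α`.
  rw [← tendsto_add_atTop_iff_nat 1]
  have e : -((Real.Gamma (-α))⁻¹ * 1) = α / Real.Gamma (1 - α) := by
    rw [hG]; field_simp
  rw [e] at h3
  refine h3.congr' ?_
  filter_upwards [eventually_gt_atTop 0] with n hn
  have hn' : (0 : ℝ) < n := by exact_mod_cast hn
  rw [Real.GammaSeq, ascPochhammer_eval_eq_prod, Real.rpow_neg hn'.le, Nat.factorial_succ]
  have e2 : (1 + 1 / (n : ℝ)) = ((n : ℝ) + 1) / n := by field_simp
  rw [e2, Real.div_rpow (by positivity) hn'.le]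
  push_cast
  rw [Real.rpow_add_one (by positivity)]
  have hp : (0 : ℝ) < (n : ℝ) ^ α := Real.rpow_pos_of_pos hn' _
  have hf : (0 : ℝ) < n.factorial := by positivity
  field_simp

/-- The Sibuya distribution has a power tail. -/
theorem exists_sibuya_tendsto {α : ℝ} (hα : 0 < α) (hα1 : α < 1) :
    ∃ s : ℕ → ℝ, (∀ n, 0 ≤ s n) ∧
      (∀ u ∈ Set.Icc (0 : ℝ) 1, HasSum (fun n => s n * u ^ n) (1 - (1 - u) ^ α)) ∧
      Tendsto (fun t : ℕ => s t * (t : ℝ) ^ (α + 1)) atTop (nhds (α / Real.Gamma (1 - α))) := by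
  obtain ⟨s, hs, hS⟩ := PDTP.exists_sibuya hα hα1
  refine ⟨s, hs, hS, ?_⟩
  -- The existence statement hides the formula for `s`; uniqueness of coefficients recovers it.
  have hb : s = fun n => (if n = 0 then 1 else 0)
      - (ascPochhammer ℝ n).eval (-α) / (n.factorial : ℝ) := by
    refine coeff_unique_of_hasSum (fun u hu => hS u ⟨hu.1, hu.2.le⟩) fun u hu => ?_
    have h := PDTP.hasSum_binomial (-α) hu.1 hu.2
    rw [neg_neg] at h
    refine ((hasSum_ite_eq 0 (1 : ℝ)).sub h).congr_fun fun n => ?_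
    by_cases hn : n = 0 <;> simp [hn]
  refine (tendsto_binomial_coeff hα hα1).congr' ?_
  filter_upwards [eventually_gt_atTop 0] with n hn
  simp [hb, hn.ne']

/-! ### Negative binomial weights and compound distributions -/

/-- The weights of the negative binomial distribution. -/
theorem summable_negBinomial_mul_pow {ν x : ℝ} (hν : 0 < ν) (hx0 : 0 < x) (hx1 : x < 1) (k : ℕ) :
    Summable fun m : ℕ => (ascPochhammer ℝ m).eval ν / (m.factorial : ℝ) * x ^ m * (m : ℝ) ^ k := by
  -- The factor `(x / y) ^ m` absorbs the power of `m`, leaving the convergent series at `y`.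
  obtain ⟨y, hxy, hy1⟩ := exists_between hx1
  have hy0 : 0 < y := hx0.trans hxy
  have h1 := (PDTP.hasSum_binomial ν hy0.le hy1).summable
  have h2 : Tendsto (fun m : ℕ => (m : ℝ) ^ k * (x / y) ^ m) atTop (nhds 0) :=
    tendsto_pow_const_mul_const_pow_of_abs_lt_one k (by
      rw [abs_of_pos (by positivity)]; exact (div_lt_one hy0).2 hxy)
  have hnn : ∀ m : ℕ, 0 ≤ (ascPochhammer ℝ m).eval ν / (m.factorial : ℝ) := fun m => by
    have := ascPochhammer_pos m ν hν
    positivity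
  refine summable_of_isBigO_nat h1 (Asymptotics.IsBigO.of_bound 1 ?_)
  filter_upwards [h2.eventually_le_const one_pos] with m hm
  have := hnn m
  rw [Real.norm_of_nonneg (by positivity), Real.norm_of_nonneg (by positivity), one_mul]
  have e : x ^ m * (m : ℝ) ^ k = y ^ m * ((m : ℝ) ^ k * (x / y) ^ m) := by
    rw [div_pow]; field_simp
  rw [mul_assoc, e]
  refine mul_le_mul_of_nonneg_left ?_ this
  exact mul_le_of_le_one_right (by positivity) hm

/-- This is `x` times the derivative of the binomial series, obtained from the coefficient identity
`(ν)_(m+1) = ν * (ν + 1)_m` instead of by differentiating. -/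
theorem hasSum_negBinomial_mul {ν x : ℝ} (hx0 : 0 ≤ x) (hx1 : x < 1) :
    HasSum (fun m : ℕ => (ascPochhammer ℝ m).eval ν / (m.factorial : ℝ) * x ^ m * (m : ℝ))
      (ν * x * (1 - x) ^ (-(ν + 1))) := by
  have h := (PDTP.hasSum_binomial (ν + 1) hx0 hx1).mul_left (ν * x)
  rw [← hasSum_nat_add_iff' 1]
  simp only [Finset.range_one, Finset.sum_singleton, Nat.cast_zero, mul_zero, sub_zero]
  refine h.congr_fun fun m => ?_
  have e : (ascPochhammer ℝ (m + 1)).eval ν = ν * (ascPochhammer ℝ m).eval (ν + 1) := by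
    simp [ascPochhammer_succ_left, Polynomial.eval_comp]
  rw [e, Nat.factorial_succ, pow_succ]
  push_cast
  have : (m.factorial : ℝ) ≠ 0 := by positivity
  field_simp

/-- Coefficients of the composition of a power series of radius larger than one with the generating
function of a distribution with a power tail. -/
theorem tendsto_compound {w s : ℕ → ℝ} {β c E : ℝ} (hβ : 0 ≤ β) (hw : ∀ m, 0 ≤ w m)
    (hwE : HasSum (fun m => w m * m) E)
    (hwβ : Summable fun m : ℕ => w m * (m * (m : ℝ) ^ β)) (hs0 : ∀ n, 0 ≤ s n) (hs : HasSum s 1)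
    (hc : Tendsto (fun t : ℕ => s t * (t : ℝ) ^ β) atTop (nhds c)) :
    Tendsto (fun t : ℕ => (∑' m, w m * PowerSeries.coeff t (PowerSeries.mk s ^ m)) * (t : ℝ) ^ β)
      atTop (nhds (E * c)) := by
  obtain ⟨C, hC0, hC⟩ := exists_abs_mul_rpow_le hc
  simp only [← tsum_mul_right]
  rw [← hwE.tsum_eq, ← tsum_mul_right]
  refine tendsto_tsum_of_dominated_convergence (hwβ.mul_left C) (fun m => ?_) ?_
  · simp only [mul_assoc]
    exact (tendsto_coeff_pow hβ hs hc m).const_mul (w m)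
  · filter_upwards [eventually_gt_atTop 0] with t ht m
    have h1 := coeff_pow_mul_rpow_le hβ hs0 hs hC0
      (fun t => by simpa [abs_of_nonneg (hs0 t)] using hC t) m t ht
    rw [Real.norm_of_nonneg (mul_nonneg (mul_nonneg (hw m) (coeff_pow_nonneg hs0 m t))
      (by positivity)), mul_assoc]
    calc _ ≤ w m * (C * (m * (m : ℝ) ^ β)) := mul_le_mul_of_nonneg_left h1 (hw m)
      _ = _ := by ring

/-- Nonnegativity makes the double family summable, so the order of summation may be exchanged. -/
theorem hasSum_compound {w s : ℕ → ℝ} {S W u : ℝ} (hw : ∀ m, 0 ≤ w m) (hs0 : ∀ n, 0 ≤ s n)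
    (hu : 0 ≤ u) (hS : HasSum (fun n => s n * u ^ n) S) (hW : HasSum (fun m => w m * S ^ m) W) :
    HasSum (fun t => (∑' m, w m * PowerSeries.coeff t (PowerSeries.mk s ^ m)) * u ^ t) W := by
  have hq := hasSum_coeff_pow hS
  have key : Summable (fun x : ℕ × ℕ =>
      w x.1 * (PowerSeries.coeff x.2 (PowerSeries.mk s ^ x.1) * u ^ x.2)) := by
    refine (summable_prod_of_nonneg fun x => mul_nonneg (hw _)
      (mul_nonneg (coeff_pow_nonneg hs0 _ _) (pow_nonneg hu _))).2
      ⟨fun m => ((hq m).mul_left (w m)).summable, ?_⟩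
    exact hW.summable.congr fun m => ((hq m).mul_left (w m)).tsum_eq.symm
  have h := key.hasSum.prod_fiberwise fun m => (hq m).mul_left (w m)
  have h2 := (Equiv.prodComm ℕ ℕ).hasSum_iff.mpr (h.unique hW ▸ key.hasSum)
  have h3 := h2.prod_fiberwise fun n => (h2.summable.prod_factor n).hasSum
  refine h3.congr_fun fun n => ?_
  simp only [← tsum_mul_right, Function.comp_apply, Equiv.prodComm_apply, Prod.swap_prod_mk,
    mul_assoc]

/-- Every sequence with the generating function `pdtpGenFun` has a power tail. -/
theorem tendsto_of_hasSum_pdtpGenFun {α ν ξ : ℝ} (hα : 0 < α) (hα1 : α < 1) (hν : 0 < ν)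
    (hξ : 0 < ξ) {p : ℕ → ℝ}
    (hp : ∀ u ∈ Set.Icc (0 : ℝ) 1, HasSum (fun n => p n * u ^ n) (pdtpGenFun α ν ξ u)) :
    Tendsto (fun t : ℕ => p t * (t : ℝ) ^ (α + 1)) atTop
      (nhds (ν / ξ * (α / Real.Gamma (1 - α)))) := by
  obtain ⟨s, hs, hS, hsα⟩ := exists_sibuya_tendsto hα hα1
  have h1ξ : 0 < 1 + ξ := by linarith
  have hx0 : 0 < 1 / (1 + ξ) := by positivity
  have hx1 : 1 / (1 + ξ) < 1 := by rw [div_lt_one h1ξ]; linarith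
  set w : ℕ → ℝ := fun n => (ξ / (1 + ξ)) ^ ν * ((ascPochhammer ℝ n).eval ν /
        (n.factorial : ℝ) * (1 / (1 + ξ)) ^ n) with hw
  have hw0 : ∀ n, 0 ≤ w n := fun n => by
    have := ascPochhammer_pos n ν hν
    positivity
  have hs1 : HasSum s 1 := by simpa [Real.zero_rpow hα.ne'] using hS 1 (by simp)
  have hW : ∀ u ∈ Set.Icc (0 : ℝ) 1, HasSum (fun n => w n * (1 - (1 - u) ^ α) ^ n)
      (ξ ^ ν / (ξ + (1 - u) ^ α) ^ ν) := by
    intro u hu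
    have hv : 0 ≤ (1 - u) ^ α := Real.rpow_nonneg (by linarith [hu.2]) _
    have hv1 : (1 - u) ^ α ≤ 1 :=
      Real.rpow_le_one (by linarith [hu.2]) (by linarith [hu.1]) hα.le
    have h := (PDTP.hasSum_binomial ν (x := (1 - (1 - u) ^ α) / (1 + ξ)) (by
      apply div_nonneg <;> linarith) (by rw [div_lt_one h1ξ]; linarith)).mul_left
        ((ξ / (1 + ξ)) ^ ν)
    have e : (ξ / (1 + ξ)) ^ ν * (1 - (1 - (1 - u) ^ α) / (1 + ξ)) ^ (-ν)
        = ξ ^ ν / (ξ + (1 - u) ^ α) ^ ν := by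
      have : 1 - (1 - (1 - u) ^ α) / (1 + ξ) = (ξ + (1 - u) ^ α) / (1 + ξ) := by
        field_simp; ring
      rw [this, Real.rpow_neg (by positivity), Real.div_rpow hξ.le h1ξ.le,
        Real.div_rpow (by positivity) h1ξ.le]
      have a1 : (0 : ℝ) < (1 + ξ) ^ ν := Real.rpow_pos_of_pos h1ξ _
      have a2 : (0 : ℝ) < (ξ + (1 - u) ^ α) ^ ν := Real.rpow_pos_of_pos (by linarith) _
      field_simp
    rw [e] at h
    refine h.congr_fun fun n => ?_
    simp only [hw, div_pow, one_pow]
    ring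
  -- The mean `ν * x / (1 - x)` at `x = 1 / (1 + ξ)`.
  have hwE : HasSum (fun m => w m * m) (ν / ξ) := by
    have h := (hasSum_negBinomial_mul (ν := ν) hx0.le hx1).mul_left ((ξ / (1 + ξ)) ^ ν)
    have e : (ξ / (1 + ξ)) ^ ν * (ν * (1 / (1 + ξ)) * (1 - 1 / (1 + ξ)) ^ (-(ν + 1))) = ν / ξ := by
      have e1 : 1 - 1 / (1 + ξ) = ξ / (1 + ξ) := by field_simp; ring
      have hpos : 0 < ξ / (1 + ξ) := by positivity
      rw [e1, Real.rpow_neg hpos.le, Real.rpow_add_one hpos.ne']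
      have := Real.rpow_pos_of_pos hpos ν
      field_simp
    rw [e] at h
    exact h.congr_fun fun m => by simp only [hw]; ring
  have hwβ : Summable fun m : ℕ => w m * (m * (m : ℝ) ^ (α + 1)) := by
    refine ((summable_negBinomial_mul_pow hν hx0 hx1 3).mul_left ((ξ / (1 + ξ)) ^ ν)).of_nonneg_of_le
      (fun m => mul_nonneg (hw0 m) (by positivity)) fun m => ?_
    rw [← mul_assoc ((ξ / (1 + ξ)) ^ ν)]
    refine mul_le_mul_of_nonneg_left ?_ (hw0 m)
    rcases Nat.eq_zero_or_pos m with rfl | hm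
    · simp
    · have h1 : (1 : ℝ) ≤ m := by exact_mod_cast hm
      have h2 : (m : ℝ) ^ (α + 1) ≤ (m : ℝ) ^ (2 : ℝ) :=
        Real.rpow_le_rpow_of_exponent_le h1 (by linarith)
      rw [Real.rpow_two] at h2
      calc (m : ℝ) * (m : ℝ) ^ (α + 1) ≤ m * (m : ℝ) ^ 2 := by gcongr
        _ = (m : ℝ) ^ 3 := by ring
  have hlim := tendsto_compound (by linarith) hw0 hwE hwβ hs hs1 hsα
  set r : ℕ → ℝ := fun t => ∑' m, w m * PowerSeries.coeff t (PowerSeries.mk s ^ m) with hr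
  -- The prefactor `u` shifts the compound weights by one place; the tail is unaffected because `((n
  -- + 1) / n) ^ (α + 1)` tends to `1`.
  have hpr : p = fun n => n.casesOn 0 r := by
    refine coeff_unique_of_hasSum (fun u hu => hp u ⟨hu.1, hu.2.le⟩) fun u hu => ?_
    have hu' : u ∈ Set.Icc (0 : ℝ) 1 := ⟨hu.1, hu.2.le⟩
    rw [← hasSum_nat_add_iff' 1]
    have h := ((hasSum_compound hw0 hs hu.1 (hS u hu') (hW u hu')).mul_left u).congr_fun
      (g := fun n => r n * u ^ (n + 1)) fun n => by simp only [hr]; ring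
    simpa [pdtpGenFun] using h
  rw [← tendsto_add_atTop_iff_nat 1, hpr]
  have h2 : Tendsto (fun n : ℕ => (1 + 1 / (n : ℝ)) ^ (α + 1)) atTop (nhds 1) := by
    have h3 := ((tendsto_const_div_atTop_nhds_zero_nat (1 : ℝ)).const_add 1).rpow_const
      (p := α + 1) (Or.inl (by simp))
    simpa using h3
  have h3 := hlim.mul h2
  rw [mul_one] at h3
  refine h3.congr' ?_
  filter_upwards [eventually_gt_atTop 0] with n hn
  have hn' : (0 : ℝ) < n := by exact_mod_cast hn
  have e : ((n + 1 : ℕ) : ℝ) = n * (1 + 1 / (n : ℝ)) := by push_cast; field_simp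
  rw [e, Real.mul_rpow hn'.le (by positivity)]
  simp only [hr]
  ring

/-! ### From point masses to tail sums -/

/-- The expression equals `t * (1 - (1 + 1 / t) ^ (-α))`, minus the slope of `x ^ (-α)` at `1` with
step `1 / t`. -/
theorem tendsto_mul_rpow_neg_sub {α : ℝ} :
    Tendsto (fun t : ℕ => ((t : ℝ) ^ (-α) - ((t + 1 : ℕ) : ℝ) ^ (-α)) * (t : ℝ) ^ (α + 1)) atTop
      (nhds α) := by
  have hd : HasDerivAt (fun x : ℝ => x ^ (-α)) (-α) 1 := by
    simpa using Real.hasDerivAt_rpow_const (x := 1) (p := -α) (Or.inl one_ne_zero)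
  have hsl := (hasDerivAt_iff_tendsto_slope_zero.mp hd).neg
  have hseq : Tendsto (fun t : ℕ => (t : ℝ)⁻¹) atTop (nhdsWithin 0 {0}ᶜ) := by
    refine tendsto_nhdsWithin_iff.mpr ⟨tendsto_inv_atTop_nhds_zero_nat, ?_⟩
    filter_upwards [eventually_gt_atTop 0] with t ht
    have : (t : ℝ) ≠ 0 := by exact_mod_cast ht.ne'
    simpa using ht.ne'
  have h := hsl.comp hseq
  rw [neg_neg] at h
  refine h.congr' ?_
  filter_upwards [eventually_gt_atTop 0] with t ht
  have ht' : (0 : ℝ) < t := by exact_mod_cast ht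
  have e : ((t + 1 : ℕ) : ℝ) = t * (1 + (t : ℝ)⁻¹) := by push_cast; field_simp
  simp only [Function.comp_apply, inv_inv, smul_eq_mul, Real.one_rpow]
  rw [e, Real.mul_rpow ht'.le (by positivity), Real.rpow_add_one ht'.ne', Real.rpow_neg ht'.le]
  have := Real.rpow_pos_of_pos ht' α
  field_simp
  ring

/-- Telescoping. At `t = 0` the convention `0 ^ (-α) = 0` would make the first term negative. -/
theorem hasSum_rpow_neg_sub {α : ℝ} (hα : 0 < α) {t : ℕ} (ht : 0 < t) :
    HasSum (fun k : ℕ => ((t + k : ℕ) : ℝ) ^ (-α) - ((t + k + 1 : ℕ) : ℝ) ^ (-α))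
      ((t : ℝ) ^ (-α)) := by
  have hanti : ∀ k : ℕ, ((t + k + 1 : ℕ) : ℝ) ^ (-α) ≤ ((t + k : ℕ) : ℝ) ^ (-α) := fun k =>
    Real.rpow_le_rpow_of_nonpos (by exact_mod_cast (by omega : 0 < t + k))
      (by exact_mod_cast Nat.le_succ _) (by linarith)
  refine (hasSum_iff_tendsto_nat_of_nonneg (fun k => sub_nonneg.2 (hanti k)) _).2 ?_
  have h1 : Tendsto (fun n : ℕ => ((t + n : ℕ) : ℝ) ^ (-α)) atTop (nhds 0) :=
    (tendsto_rpow_neg_atTop hα).comp (tendsto_natCast_atTop_atTop.comp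
      (tendsto_atTop_mono (fun n => Nat.le_add_left n t) tendsto_id))
  have h2 := h1.const_sub ((t : ℝ) ^ (-α))
  rw [sub_zero] at h2
  refine h2.congr fun n => ?_
  simpa [add_assoc] using (Finset.sum_range_sub' (fun k => ((t + k : ℕ) : ℝ) ^ (-α)) n).symm

/-- The tail sums of a sequence that decays like `t ^ (-α - 1)`. -/
theorem tendsto_tail {f : ℕ → ℝ} {α c : ℝ} (hα : 0 < α) (hf : Summable f)
    (hc : Tendsto (fun t : ℕ => f t * (t : ℝ) ^ (α + 1)) atTop (nhds c)) :
    Tendsto (fun t : ℕ => (∑' k, f (t + 1 + k)) * (t : ℝ) ^ α) atTop (nhds (c / α)) := by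
  -- A discrete l'Hôpital rule: `f (k + 1)` is compared with `d k`, whose tail sums telescope to `t
  -- ^ (-α)`. A termwise error of `ε / 2 * d` sums to `ε / 2 * t ^ (-α)`.
  set d : ℕ → ℝ := fun k => (k : ℝ) ^ (-α) - ((k + 1 : ℕ) : ℝ) ^ (-α) with hd
  have hdpos : ∀ k : ℕ, 0 < k → 0 < d k := fun k hk => by
    have hk' : (0 : ℝ) < k := by exact_mod_cast hk
    exact sub_pos.2 (Real.rpow_lt_rpow_of_neg hk' (by push_cast; linarith) (by linarith))
  have hratio : Tendsto (fun k : ℕ => f (k + 1) / d k) atTop (nhds (c / α)) := by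
    have h1 := ((tendsto_add_atTop_iff_nat 1).2 hc)
    have h2 : Tendsto (fun n : ℕ => (1 + 1 / (n : ℝ)) ^ (α + 1)) atTop (nhds 1) := by
      have h3 := ((tendsto_const_div_atTop_nhds_zero_nat (1 : ℝ)).const_add 1).rpow_const
        (p := α + 1) (Or.inl (by simp))
      simpa using h3
    have h3 := (h1.div h2 one_ne_zero).div (tendsto_mul_rpow_neg_sub (α := α)) hα.ne'
    rw [div_one] at h3
    refine h3.congr' ?_
    filter_upwards [eventually_gt_atTop 0] with n hn
    have hn' : (0 : ℝ) < n := by exact_mod_cast hn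
    have e : ((n + 1 : ℕ) : ℝ) ^ (α + 1) = (n : ℝ) ^ (α + 1) * (1 + 1 / (n : ℝ)) ^ (α + 1) := by
      rw [← Real.mul_rpow hn'.le (by positivity)]
      congr 1; push_cast; field_simp
    have hd' := (hdpos n hn).ne'
    have p1 := (Real.rpow_pos_of_pos hn' (α + 1)).ne'
    have p2 := (Real.rpow_pos_of_pos (show 0 < 1 + 1 / (n : ℝ) by positivity) (α + 1)).ne'
    simp only [Pi.div_apply]
    rw [e, ← show d n = (n : ℝ) ^ (-α) - ((n + 1 : ℕ) : ℝ) ^ (-α) from rfl]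
    field_simp
  rw [Metric.tendsto_atTop] at hratio ⊢
  intro ε hε
  obtain ⟨N, hN⟩ := hratio (ε / 2) (by positivity)
  refine ⟨N + 1, fun t ht => ?_⟩
  have ht' : (0 : ℝ) < t := by exact_mod_cast (by omega : 0 < t)
  have hD : HasSum (fun k => d (t + k)) ((t : ℝ) ^ (-α)) := hasSum_rpow_neg_sub hα (by omega)
  have hF : Summable fun k => f (t + 1 + k) := by
    simpa [add_comm] using (summable_nat_add_iff (t + 1)).2 hf
  have hbd : ∀ k, ‖f (t + 1 + k) - c / α * d (t + k)‖ ≤ ε / 2 * d (t + k) := fun k => by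
    have h1 := (hN (t + k) (by omega)).le
    have h2 := hdpos (t + k) (by omega)
    rw [Real.dist_eq] at h1
    have e : f (t + 1 + k) - c / α * d (t + k) = (f (t + k + 1) / d (t + k) - c / α) * d (t + k) := by
      rw [sub_mul, div_mul_cancel₀ _ h2.ne', add_right_comm t 1 k]
    rw [e, norm_mul, Real.norm_eq_abs, Real.norm_of_nonneg h2.le]
    exact mul_le_mul_of_nonneg_right h1 h2.le
  have h1 := tsum_of_norm_bounded (hD.mul_left (ε / 2)) hbd
  rw [hF.tsum_sub (hD.summable.mul_left _), tsum_mul_left, hD.tsum_eq, Real.norm_eq_abs] at h1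
  have hinv : (t : ℝ) ^ (-α) * (t : ℝ) ^ α = 1 := by
    rw [← Real.rpow_add ht']; simp
  have hp := Real.rpow_pos_of_pos ht' α
  have h2 := mul_le_mul_of_nonneg_right h1 hp.le
  rw [← abs_of_pos hp, ← abs_mul, abs_of_pos hp, sub_mul, mul_assoc, mul_assoc, hinv, mul_one,
    mul_one] at h2
  rw [Real.dist_eq]
  linarith

/-! ### Laws of the arrival times -/

section
variable {Ω : Type*} [MeasurableSpace Ω] {P : Measure Ω}
  {α ν ξ : ℝ} {Z : ℕ → Ω → ℕ}

/-- Identical distribution is not a field of `IsPDTP`; it follows from the common generating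
function. -/
theorem IsPDTP.law_eq (hZ : IsPDTP P α ν ξ Z) (j t : ℕ) :
    P.real {ω | Z j ω = t} = interArrivalProb P Z t :=
  congrFun (coeff_unique_of_hasSum (F := pdtpGenFun α ν ξ)
    (fun u hu => hZ.genFun j u ⟨hu.1, hu.2.le⟩) fun u hu => hZ.genFun 0 u ⟨hu.1, hu.2.le⟩) t

theorem IsPDTP.measurable_arrivalTime (hZ : IsPDTP P α ν ξ Z) (n : ℕ) :
    Measurable (arrivalTime Z n) :=
  Finset.measurable_sum _ fun j _ => hZ.measurable j

theorem IsPDTP.arrivalTime_law [IsProbabilityMeasure P] (hZ : IsPDTP P α ν ξ Z) (n t : ℕ) :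
    P.real {ω | arrivalTime Z n ω = t}
      = PowerSeries.coeff t (PowerSeries.mk (interArrivalProb P Z) ^ n) := by
  induction n generalizing t with
  | zero =>
    rw [pow_zero, PowerSeries.coeff_one]
    by_cases ht : t = 0
    · simp [arrivalTime, ht]
    · simp [arrivalTime, ht, Ne.symm ht]
  | succ n ih =>
    have hind : IndepFun (arrivalTime Z n) (Z n) P := by
      have h := hZ.indep.indepFun_finsetSum_of_notMem hZ.measurable
        (Finset.notMem_range_self (n := n))
      convert h using 1
      funext ω
      simp [arrivalTime]
    have hset : {ω | arrivalTime Z (n + 1) ω = t} = ⋃ kl ∈ antidiagonal t,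
        arrivalTime Z n ⁻¹' {kl.1} ∩ Z n ⁻¹' {kl.2} := by
      ext ω
      simp [arrivalTime, Finset.sum_range_succ]
    rw [hset, measureReal_biUnion_finset]
    · rw [pow_succ, PowerSeries.coeff_mul]
      refine Finset.sum_congr rfl fun kl _ => ?_
      rw [measureReal_def, hind.measure_inter_preimage_eq_mul _ _ (measurableSet_singleton _)
        (measurableSet_singleton _), ENNReal.toReal_mul, PowerSeries.coeff_mk, ← ih, ← hZ.law_eq n]
      rfl
    · intro x _ y _ hxy
      refine Set.disjoint_left.2 fun ω h1 h2 => hxy ?_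
      exact Prod.ext (h1.1.symm.trans h2.1) (h1.2.symm.trans h2.2)
    · exact fun kl _ => (hZ.measurable_arrivalTime n (measurableSet_singleton _)).inter
        (hZ.measurable n (measurableSet_singleton _))

theorem hasSum_measureReal_fiber [IsProbabilityMeasure P] {J : Ω → ℕ} (hJ : Measurable J) (t : ℕ) :
    HasSum (fun k => P.real {ω | J ω = t + 1 + k}) (P.real {ω | t < J ω}) := by
  have hset : {ω | t < J ω} = ⋃ k, {ω | J ω = t + 1 + k} := by
    ext ω
    simp only [Set.mem_ofPred_eq, Set.mem_iUnion]
    exact ⟨fun h => ⟨J ω - (t + 1), by omega⟩, fun ⟨k, hk⟩ => by omega⟩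
  have h := measure_iUnion (μ := P) (f := fun k => {ω | J ω = t + 1 + k})
    (fun i j hij => Set.disjoint_left.2 fun ω h1 h2 => hij (by
      simp only [Set.mem_ofPred_eq] at h1 h2; omega))
    fun k => hJ (measurableSet_singleton _)
  rw [hset, measureReal_def, h, ENNReal.tsum_toReal_eq fun k => measure_ne_top _ _]
  exact (ENNReal.summable_toReal (h ▸ measure_ne_top _ _)).hasSum

/-- Arrival times increase with `n`, so the two tail events are nested and the state event is their
difference. -/
theorem IsPDTP.stateProb_eq [IsProbabilityMeasure P] (hZ : IsPDTP P α ν ξ Z) (n t : ℕ) :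
    stateProb P Z n t = P.real {ω | t < arrivalTime Z (n + 1) ω}
      - P.real {ω | t < arrivalTime Z n ω} := by
  have hle : ∀ ω, arrivalTime Z n ω ≤ arrivalTime Z (n + 1) ω := fun ω => by
    simp [arrivalTime, Finset.sum_range_succ]
  have hsub : {ω | t < arrivalTime Z n ω} ⊆ {ω | t < arrivalTime Z (n + 1) ω} :=
    fun ω (h : t < arrivalTime Z n ω) => lt_of_lt_of_le h (hle ω)
  rw [← measureReal_sdiff hsub
    (measurableSet_lt measurable_const (hZ.measurable_arrivalTime n)), stateProb]
  congr 1
  ext ω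
  simp [and_comm]

/-- Stated as a limit rather than an equivalence so that `n = 0`, with limit zero, is included. -/
theorem IsPDTP.tendsto_arrivalTime_tail [IsProbabilityMeasure P] (hZ : IsPDTP P α ν ξ Z) (hα : 0 < α) (hα1 : α < 1)
    (hν : 0 < ν) (hξ : 0 < ξ) (n : ℕ) :
    Tendsto (fun t : ℕ => P.real {ω | t < arrivalTime Z n ω} * (t : ℝ) ^ α) atTop
      (nhds (n * (ν / ξ * (α / Real.Gamma (1 - α))) / α)) := by
  have hθ := tendsto_of_hasSum_pdtpGenFun hα hα1 hν hξ (hZ.genFun 0)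
  have h1 : HasSum (interArrivalProb P Z) 1 := by
    have h := hZ.genFun 0 1 (by simp)
    simp only [one_pow, mul_one] at h
    have e : pdtpGenFun α ν ξ 1 = 1 := by
      simp [pdtpGenFun, Real.zero_rpow hα.ne', (Real.rpow_pos_of_pos hξ ν).ne']
    rw [e] at h
    exact h
  have h := tendsto_tail hα (hasSum_coeff_pow_one h1 n).summable (tendsto_coeff_pow (by linarith) h1 hθ n)
  refine h.congr fun t => ?_
  rw [← (hasSum_measureReal_fiber (hZ.measurable_arrivalTime n) t).tsum_eq]
  simp only [hZ.arrivalTime_law]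

end

/-! ### Asymptotic equivalence -/

theorem isEquivalent_of_tendsto_mul_rpow {f : ℕ → ℝ} {β c : ℝ} (hc : c ≠ 0)
    (h : Tendsto (fun t : ℕ => f t * (t : ℝ) ^ β) atTop (nhds c)) :
    Asymptotics.IsEquivalent atTop f fun t : ℕ => c * (t : ℝ) ^ (-β) := by
  refine Asymptotics.isEquivalent_of_tendsto_one ?_
  have h1 := h.div_const c
  rw [div_self hc] at h1
  refine h1.congr' ?_
  filter_upwards [eventually_gt_atTop 0] with t ht
  have ht' : (0 : ℝ) < t := by exact_mod_cast ht
  have := Real.rpow_pos_of_pos ht' β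
  rw [Pi.div_apply, Real.rpow_neg ht'.le]
  field_simp

theorem mainTheorem4 {Ω : Type*} [MeasurableSpace Ω] (P : Measure Ω) [IsProbabilityMeasure P]
    (α ν ξ : ℝ) (hα : 0 < α) (hα1 : α < 1) (hν : 0 < ν) (hξ : 0 < ξ)
    (Z : ℕ → Ω → ℕ) (hZ : IsPDTP P α ν ξ Z) :
    (∀ n : ℕ, Asymptotics.IsEquivalent atTop (fun t : ℕ => stateProb P Z n t)
      (fun t : ℕ => ν / ξ * ((t : ℝ) ^ (-α) / Real.Gamma (1 - α)))) ∧
    Asymptotics.IsEquivalent atTop (fun t : ℕ => interArrivalProb P Z t)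
      (fun t : ℕ => α * ν / ξ * ((t : ℝ) ^ (-α - 1) / Real.Gamma (1 - α))) := by
  have hG : 0 < Real.Gamma (1 - α) := Real.Gamma_pos_of_pos (by linarith)
  constructor
  · intro n
    have h := (hZ.tendsto_arrivalTime_tail hα hα1 hν hξ (n + 1)).sub
      (hZ.tendsto_arrivalTime_tail hα hα1 hν hξ n)
    -- The tail constants are linear in `n`, so their increment does not depend on `n`.
    have e : ((n + 1 : ℕ) : ℝ) * (ν / ξ * (α / Real.Gamma (1 - α))) / α
        - n * (ν / ξ * (α / Real.Gamma (1 - α))) / α = ν / ξ / Real.Gamma (1 - α) := by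
      push_cast
      field_simp
      ring
    rw [e] at h
    have h2 := isEquivalent_of_tendsto_mul_rpow (f := fun t => stateProb P Z n t)
      (by positivity) (h.congr fun t => by rw [hZ.stateProb_eq, sub_mul])
    convert h2 using 2 with t
    ring
  · have h2 := isEquivalent_of_tendsto_mul_rpow (f := fun t => interArrivalProb P Z t)
      (by positivity) (tendsto_of_hasSum_pdtpGenFun hα hα1 hν hξ (hZ.genFun 0))
    convert h2 using 2 with t
    rw [show -(α + 1) = -α - 1 by ring]
    ring
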